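/- Let $n \ge 0$ be an integer. For $k \in \{1,\dots,n\}$ the addition operator $A^{(k)}$ on $\{0,1\}^n$ sends $x=(x_1,\dots,x_n)$ to the sequence obtained by setting the $k$-th entry to $1$. For $k \in \{2,\dots,n\}$ the left-swap operator $L^{(k)}$ on $\{0,1\}^n$ exchanges the entries at positions $k-1$ and $k$ of $x$ if $x_{k-1}=0$ and $x_k=1$, and leaves $x$ unchanged otherwise. Let $\preceq_1$ be the partial order on $\{0,1\}^n$ generated by these operators: $x \preceq_1 y$ if and only if $y$ is obtained from $x$ by applying finitely many (possibly zero) operators $A^{(k)}$ and $L^{(k)}$. An antichain is a subset of $\{0,1\}^n$ no two distinct elements of which are comparable. Let $M(n)$ be the maximal number of subsets of $\{1,\dots,n\}$ that share the same sum of elements. Then $$\max_{\mathcal A} |\mathcal A| = M(n),$$ where the maximum is over all antichains $\mathcal A$ of $(\{0,1\}^n, \preceq_1)$. -/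

import Mathlib

namespace PolarOrder

/-- The addition operator at position `k` on the Hamming cube `{0,1}^n`: it sets the `k`-th bit
to `1`. A point of the cube is `x = (x 0, …, x (n-1))`, written from left (most significant bit)
to right, so that index `k : Fin n` is the position `k + 1 ∈ {1, …, n}`. -/
def addition {n : ℕ} (k : Fin n) (x : Fin n → Bool) : Fin n → Bool :=
  fun l => if l = k then true else x l

/-- The index immediately to the left of `k`, for `k` not the leftmost index. -/
def left {n : ℕ} (k : Fin n) (_hk : 0 < k.val) : Fin n :=
  ⟨k.val - 1, lt_of_le_of_lt (Nat.sub_le _ _) k.isLt⟩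

/-- The left-swap operator at position `k` (not the leftmost one): if the `k`-th bit is `1` and
the bit on its left is `0`, it swaps them; otherwise it does nothing. -/
def leftSwap {n : ℕ} (k : Fin n) (hk : 0 < k.val) (x : Fin n → Bool) : Fin n → Bool :=
  if x k = true ∧ x (left k hk) = false then
    fun l => if l = left k hk then true else if l = k then false else x l
  else x

/-- `Step x y`: the point `y` is obtained from `x` by one addition or one left-swap operator. -/
inductive Step {n : ℕ} : (Fin n → Bool) → (Fin n → Bool) → Prop
  | add (x : Fin n → Bool) (k : Fin n) : Step x (addition k x)
  | swap (x : Fin n → Bool) (k : Fin n) (hk : 0 < k.val) : Step x (leftSwap k hk x)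

/-- The order on the Hamming cube `{0,1}^n` generated by the two operators: `Le₁ x y` means that
`y` is obtained from `x` by applying finitely many (possibly zero) addition and left-swap
operators. -/
def Le₁ {n : ℕ} (x y : Fin n → Bool) : Prop :=
  Relation.ReflTransGen Step x y

theorem Step.toLex_le {n : ℕ} {x y : Fin n → Bool} (h : Step x y) : toLex x ≤ toLex y := by
  cases h with
  | add k =>
    refine Pi.toLex_monotone fun l => ?_
    unfold addition
    split_ifs
    · exact Bool.le_true _
    · exact le_rfl
  | swap k hk =>
    unfold leftSwap
    split_ifs with hc
    · refine le_of_lt ⟨left k hk, fun l hl => ?_, ?_⟩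
      · have h1 : l ≠ left k hk := ne_of_lt hl
        have h2 : l ≠ k := by
          rintro rfl
          have : l.val < l.val - 1 := hl
          omega
        simp [h1, h2]
      · simp [hc.2]
    · exact le_rfl

theorem Le₁.toLex_le {n : ℕ} {x y : Fin n → Bool} (h : Le₁ x y) : toLex x ≤ toLex y := by
  induction h with
  | refl => exact le_rfl
  | tail _ hs ih => exact ih.trans hs.toLex_le

/-- The relation `Le₁` is a partial order. -/
instance isPartialOrder_le₁ (n : ℕ) : IsPartialOrder (Fin n → Bool) Le₁ where
  refl _ := Relation.ReflTransGen.refl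
  trans _ _ _ := Relation.ReflTransGen.trans
  antisymm _ _ hxy hyx := toLex.injective (le_antisymm hxy.toLex_le hyx.toLex_le)

/-- The number of subsets of `{1, …, n}` whose elements sum to `s`. -/
def countSum (n s : ℕ) : ℕ :=
  ((Finset.Icc 1 n).powerset.filter fun T => ∑ i ∈ T, i = s).card

/-- `M(n)`: the maximal number of subsets of `{1, …, n}` that share the same sum. -/
noncomputable def M (n : ℕ) : ℕ := ⨆ s : ℕ, countSum n s

/-- The supremum defining `M n` is a maximum. -/
theorem isGreatest_M (n : ℕ) : IsGreatest (Set.range (countSum n)) (M n) := by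
  have hb : BddAbove (Set.range (countSum n)) := by
    refine ⟨(Finset.Icc 1 n).powerset.card, ?_⟩
    rintro _ ⟨s, rfl⟩
    exact Finset.card_filter_le _ _
  exact ⟨Nat.sSup_mem (Set.range_nonempty _) hb, fun _ h => le_csSup hb h⟩

end PolarOrder

namespace PolarOrder

open Finset

variable {n : ℕ}

/-! Give a one at index `i` the weight `n - i`, so that `rank` is strictly increasing along the
order and each level is an antichain of size `countSum n s`. The upper bound is an sl₂ argument.
`raise` and `lower` are mutually adjoint operators moving functions one level up or down along order
relations, weighted so that their commutator is diagonal with entry `n (n + 1) / 2 - 2 * rank`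
(`sum_raise_sq_sub_sum_lower_sq`). Hence `raise` is injective on every level below `n (n + 1) / 4`,
and `lower` on every level above. By Hall's theorem injectivity yields matchings between consecutive
levels (`exists_matching_of_injective`), along which any antichain is pushed, without changing its
size, into level `⌊n (n + 1) / 4⌋` (`exists_antichain_le_rank`). -/

/-! ### Elementary moves between adjacent levels -/

/-- Negate the entries at positions `i` and `i + 1` (only at `i` if it is the last position). -/
def flipAt (i : Fin n) (x : Fin n → Bool) : Fin n → Bool :=
  fun l => if l = i ∨ l.val = i.val + 1 then !x l else x l

/-- A one can be moved into position `i` from the position on its right, or, at the last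
position, be added. -/
def CanRaise (i : Fin n) (x : Fin n → Bool) : Prop :=
  x i = false ∧ ∀ h : i.val + 1 < n, x ⟨i.val + 1, h⟩ = true

/-- A one can be moved out of position `i` to the position on its right, or, at the last
position, be removed. -/
def CanLower (i : Fin n) (x : Fin n → Bool) : Prop :=
  x i = true ∧ ∀ h : i.val + 1 < n, x ⟨i.val + 1, h⟩ = false

instance (i : Fin n) (x : Fin n → Bool) : Decidable (CanRaise i x) := by
  unfold CanRaise; infer_instance

instance (i : Fin n) (x : Fin n → Bool) : Decidable (CanLower i x) := by
  unfold CanLower; infer_instance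

theorem flipAt_flipAt (i : Fin n) (x : Fin n → Bool) : flipAt i (flipAt i x) = x := by
  funext l
  unfold flipAt
  split_ifs <;> simp

theorem flipAt_comm (i j : Fin n) (x : Fin n → Bool) :
    flipAt i (flipAt j x) = flipAt j (flipAt i x) := by
  funext l
  unfold flipAt
  split_ifs <;> rfl

/-- `flipAt i` as a permutation of the cube. -/
def flipEquiv (i : Fin n) : Equiv.Perm (Fin n → Bool) where
  toFun := flipAt i
  invFun := flipAt i
  left_inv := flipAt_flipAt i
  right_inv := flipAt_flipAt i

theorem canRaise_flipAt (i : Fin n) (x : Fin n → Bool) :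
    CanRaise i (flipAt i x) ↔ CanLower i x := by
  simp [CanRaise, CanLower, flipAt]

theorem canLower_flipAt (i : Fin n) (x : Fin n → Bool) :
    CanLower i (flipAt i x) ↔ CanRaise i x := by
  simp [CanRaise, CanLower, flipAt]

/-- Moves at non-adjacent positions touch disjoint entries and commute; at adjacent positions both
sides are impossible, as they ask for opposite values of a shared entry. This makes the off-diagonal
terms of the commutator cancel. -/
theorem canRaise_and_canLower_flipAt {i j : Fin n} (hij : i ≠ j) (x : Fin n → Bool) :
    CanRaise i x ∧ CanLower j (flipAt i x) ↔ CanLower j x ∧ CanRaise i (flipAt j x) := by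
  have hv : i.val ≠ j.val := fun h => hij (Fin.ext h)
  by_cases h1 : j.val = i.val + 1
  · have hj : j = ⟨i.val + 1, h1 ▸ j.isLt⟩ := Fin.ext h1
    have hi : i.val + 1 < n := h1 ▸ j.isLt
    constructor
    · rintro ⟨⟨_, h⟩, h', _⟩
      have := h hi
      rw [← hj] at this
      simp [flipAt, h1, this] at h'
    · rintro ⟨⟨h', _⟩, _, h⟩
      have := h hi
      rw [← hj] at this
      simp [flipAt, h'] at this
  by_cases h2 : i.val = j.val + 1
  · have hj : i = ⟨j.val + 1, h2 ▸ i.isLt⟩ := Fin.ext h2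
    have hi : j.val + 1 < n := h2 ▸ i.isLt
    constructor
    · rintro ⟨⟨h', _⟩, _, h⟩
      have := h hi
      rw [← hj] at this
      simp [flipAt, h'] at this
    · rintro ⟨⟨_, h⟩, h', _⟩
      have := h hi
      rw [← hj] at this
      simp [flipAt, h2, this] at h'
  · have e1 : CanLower j (flipAt i x) ↔ CanLower j x := by
      simp [CanLower, flipAt, hij.symm, h1, hv.symm, Fin.ext_iff, Ne.symm h2]
    have e2 : CanRaise i (flipAt j x) ↔ CanRaise i x := by
      simp [CanRaise, flipAt, hij, h2, hv, Fin.ext_iff, Ne.symm h1]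
    rw [e1, e2, and_comm]

/-! ### Rank and the order -/

/-- The sum of the weights `n - i` of the positions holding a one. -/
def rank (x : Fin n → Bool) : ℕ := ∑ i, if x i then n - i.val else 0

theorem rank_addition {k : Fin n} {x : Fin n → Bool} (h : x k = false) :
    rank (addition k x) = rank x + (n - k.val) := by
  unfold rank
  rw [← Finset.add_sum_erase _ _ (mem_univ k), ← Finset.add_sum_erase (a := k) (s := univ)
    (fun i => if x i then n - i.val else 0) (mem_univ k)]
  have : ∀ l ∈ univ.erase k, (if addition k x l then n - l.val else 0) =
      if x l then n - l.val else 0 := by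
    intro l hl
    simp [addition, ne_of_mem_erase hl]
  rw [sum_congr rfl this]
  simp [addition, h]
  omega

theorem rank_leftSwap {k : Fin n} {hk : 0 < k.val} {x : Fin n → Bool}
    (h : x k = true ∧ x (left k hk) = false) : rank (leftSwap k hk x) = rank x + 1 := by
  have hne : left k hk ≠ k := by
    intro h'
    have := congrArg Fin.val h'
    simp only [left] at this
    omega
  -- both sides are obtained by an addition to the point with the `k`-th entry erased
  have e1 : leftSwap k hk x = addition (left k hk) (Function.update x k false) := by
    funext l
    simp only [leftSwap, h, and_self, if_true, addition, Function.update_apply]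
  have e2 : x = addition k (Function.update x k false) := by
    funext l
    by_cases hl : l = k <;> simp [addition, hl, h.1]
  rw [e1, rank_addition (by simp [hne, h.2])]
  conv_rhs => rw [e2, rank_addition (by simp)]
  have : k.val < n := k.isLt
  simp only [left]
  omega

theorem Step.eq_or_rank_lt {x y : Fin n → Bool} (h : Step x y) : x = y ∨ rank x < rank y := by
  cases h with
  | add k =>
    by_cases hx : x k = true
    · left
      funext l
      by_cases hl : l = k <;> simp [addition, hl, hx]
    · right
      rw [rank_addition (by simpa using hx)]
      have := k.isLt
      omega
  | swap k hk =>
    by_cases hx : x k = true ∧ x (PolarOrder.left k hk) = false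
    · right
      rw [rank_leftSwap hx]
      omega
    · left
      simp only [leftSwap, if_neg hx]

theorem Le₁.eq_or_rank_lt {x y : Fin n → Bool} (h : Le₁ x y) : x = y ∨ rank x < rank y := by
  induction h with
  | refl => exact Or.inl rfl
  | tail _ hs ih =>
    rcases ih with rfl | ih
    · exact hs.eq_or_rank_lt
    · rcases hs.eq_or_rank_lt with rfl | h
      · exact Or.inr ih
      · exact Or.inr (ih.trans h)

theorem step_and_rank_flipAt {i : Fin n} {x : Fin n → Bool} (h : CanRaise i x) :
    Step x (flipAt i x) ∧ rank (flipAt i x) = rank x + 1 := by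
  by_cases hi : i.val + 1 < n
  · have hk : 0 < (⟨i.val + 1, hi⟩ : Fin n).val := Nat.succ_pos _
    have hl : left ⟨i.val + 1, hi⟩ hk = i := Fin.ext (by simp [left])
    have hc : x ⟨i.val + 1, hi⟩ = true ∧ x (left ⟨i.val + 1, hi⟩ hk) = false :=
      ⟨h.2 hi, by rw [hl]; exact h.1⟩
    have e : flipAt i x = leftSwap ⟨i.val + 1, hi⟩ hk x := by
      funext l
      rw [leftSwap, if_pos hc, hl]
      by_cases h1 : l = i
      · simp [flipAt, h1, h.1]
      by_cases h2 : l = ⟨i.val + 1, hi⟩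
      · simp [flipAt, h2, h.2 hi, Fin.ext_iff]
      · have h3 : l.val ≠ i.val + 1 := fun h => h2 (Fin.ext h)
        simp [flipAt, h1, h2, h3]
    rw [e]
    exact ⟨Step.swap x _ hk, rank_leftSwap hc⟩
  · have e : flipAt i x = addition i x := by
      funext l
      have h3 : l.val ≠ i.val + 1 := by have := l.isLt; omega
      by_cases h1 : l = i
      · simp [flipAt, addition, h1, h.1]
      · simp [flipAt, addition, h1, h3]
    rw [e]
    refine ⟨Step.add x i, ?_⟩
    rw [rank_addition h.1]
    have := i.isLt
    omega

/-! ### The sl₂ commutation relation -/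

/-- The coefficients of the raising operator, before taking square roots. -/
noncomputable def coeff (i : Fin n) : ℝ :=
  (n * (n + 1) - (n - i) * (n - i - 1)) * if i.val + 1 = n then 1 / 2 else 1

theorem coeff_pos (i : Fin n) : 0 < coeff i := by
  have h1 : (i.val : ℝ) + 1 ≤ n := by exact_mod_cast i.isLt
  have h0 : (0 : ℝ) ≤ i.val := Nat.cast_nonneg _
  unfold coeff
  refine mul_pos ?_ (by split_ifs <;> norm_num)
  nlinarith

/-- The weight operator is diagonal with entries `n (n + 1) / 2 - 2 * rank`. -/
theorem sum_coeff_mul (x : Fin n → Bool) :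
    ∑ i, coeff i * ((if CanRaise i x then 1 else 0) - if CanLower i x then 1 else 0) =
      (n * (n + 1) / 2 : ℝ) - 2 * rank x := by
  -- The value `1 / 2` past the end makes the last position, with its halved coefficient, follow the
  -- same formula `u (i + 1) - u i` as the others.
  set u : ℕ → ℝ := fun k => if h : k < n then (if x ⟨k, h⟩ then 1 else 0) else 1 / 2 with hu
  -- Summation by parts: consecutive coefficients differ by twice the rank weight, and the constant
  -- `n (n + 1)` kills the boundary term at the left end.
  have abel : ∀ m : ℕ, ∑ i ∈ range m, ((n * (n + 1) : ℝ) - (n - i) * (n - i - 1)) *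
      (u (i + 1) - u i) = (n * (n + 1) - (n - m + 1) * (n - m)) * u m -
        2 * ∑ i ∈ range m, (n - i) * u i := by
    intro m
    induction m with
    | zero => simp; left; ring
    | succ m ih =>
      rw [sum_range_succ, ih, sum_range_succ]
      push_cast
      ring
  have hterm : ∀ i : Fin n,
      coeff i * ((if CanRaise i x then 1 else 0) - if CanLower i x then 1 else 0) =
      ((n * (n + 1) : ℝ) - (n - i.val) * (n - i.val - 1)) * (u (i.val + 1) - u i.val) := by
    intro i
    unfold coeff
    by_cases hi : i.val + 1 < n
    · rw [if_neg hi.ne, mul_one]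
      congr 1
      simp only [hu, hi, i.isLt, dif_pos, CanRaise, CanLower, forall_true_left]
      cases x i <;> cases x ⟨i.val + 1, hi⟩ <;> simp
    · have hi' : i.val + 1 = n := by have := i.isLt; omega
      rw [if_pos hi', mul_assoc]
      congr 1
      simp only [hu, hi, i.isLt, dif_pos, dif_neg, CanRaise, CanLower, not_false_eq_true,
        IsEmpty.forall_iff, and_true]
      cases x i <;> norm_num
  have hrank : (rank x : ℝ) = ∑ i ∈ range n, (n - i) * u i := by
    rw [Finset.sum_range, rank, Nat.cast_sum]
    refine sum_congr rfl fun i _ => ?_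
    simp only [hu, i.isLt, dif_pos]
    split_ifs
    · rw [Nat.cast_sub i.isLt.le, mul_one]
    · simp
  have hn : u n = 1 / 2 := by simp [hu]
  rw [sum_congr rfl fun i _ => hterm i, hrank, ← Finset.sum_range
    (fun i : ℕ => ((n * (n + 1) : ℝ) - (n - i) * (n - i - 1)) * (u (i + 1) - u i)), abel n, hn]
  ring

/-- The raising operator on functions on the cube. -/
noncomputable def raise : ((Fin n → Bool) → ℝ) →ₗ[ℝ] ((Fin n → Bool) → ℝ) where
  toFun v y := ∑ i, if CanLower i y then √(coeff i) * v (flipAt i y) else 0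
  map_add' v w := by
    funext y
    simp only [Pi.add_apply, ← sum_add_distrib]
    exact sum_congr rfl fun i _ => by split_ifs <;> ring
  map_smul' c v := by
    funext y
    simp only [Pi.smul_apply, smul_eq_mul, mul_sum, RingHom.id_apply]
    exact sum_congr rfl fun i _ => by split_ifs <;> ring

/-- The lowering operator on functions on the cube, adjoint to `raise`. -/
noncomputable def lower : ((Fin n → Bool) → ℝ) →ₗ[ℝ] ((Fin n → Bool) → ℝ) where
  toFun v y := ∑ i, if CanRaise i y then √(coeff i) * v (flipAt i y) else 0
  map_add' v w := by
    funext y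
    simp only [Pi.add_apply, ← sum_add_distrib]
    exact sum_congr rfl fun i _ => by split_ifs <;> ring
  map_smul' c v := by
    funext y
    simp only [Pi.smul_apply, smul_eq_mul, mul_sum, RingHom.id_apply]
    exact sum_congr rfl fun i _ => by split_ifs <;> ring

theorem raise_apply (v : (Fin n → Bool) → ℝ) (y : Fin n → Bool) :
    raise v y = ∑ i, if CanLower i y then √(coeff i) * v (flipAt i y) else 0 := rfl

theorem lower_apply (v : (Fin n → Bool) → ℝ) (y : Fin n → Bool) :
    lower v y = ∑ i, if CanRaise i y then √(coeff i) * v (flipAt i y) else 0 := rfl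

theorem sum_raise_sq (v : (Fin n → Bool) → ℝ) :
    ∑ y, raise v y ^ 2 = ∑ i, ∑ j, √(coeff i) * √(coeff j) *
      ∑ z, if CanRaise i z ∧ CanLower j (flipAt i z) then v z * v (flipAt j (flipAt i z))
        else 0 := by
  simp only [raise_apply, sq, sum_mul_sum]
  rw [sum_comm]
  refine sum_congr rfl fun i _ => ?_
  rw [sum_comm]
  refine sum_congr rfl fun j _ => ?_
  rw [← Equiv.sum_comp (flipEquiv i), mul_sum]
  refine sum_congr rfl fun z _ => ?_
  simp only [flipEquiv, Equiv.coe_fn_mk, canLower_flipAt, flipAt_flipAt]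
  by_cases h1 : CanRaise i z <;> by_cases h2 : CanLower j (flipAt i z) <;> simp [h1, h2]
  ring

theorem sum_lower_sq (v : (Fin n → Bool) → ℝ) :
    ∑ y, lower v y ^ 2 = ∑ i, ∑ j, √(coeff i) * √(coeff j) *
      ∑ z, if CanLower j z ∧ CanRaise i (flipAt j z) then v z * v (flipAt j (flipAt i z))
        else 0 := by
  simp only [lower_apply, sq, sum_mul_sum]
  rw [sum_comm]
  refine sum_congr rfl fun i _ => ?_
  rw [sum_comm]
  refine sum_congr rfl fun j _ => ?_
  -- Substituting with `j`, where `sum_raise_sq` uses `i`, gives the same summand there and here, up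
  -- to the side condition.
  rw [← Equiv.sum_comp (flipEquiv j), mul_sum]
  refine sum_congr rfl fun z _ => ?_
  simp only [flipEquiv, Equiv.coe_fn_mk, canRaise_flipAt, flipAt_flipAt, flipAt_comm j i]
  by_cases h1 : CanLower j z <;> by_cases h2 : CanRaise i (flipAt j z) <;> simp [h1, h2]
  ring

/-- The commutation relation of the raising and lowering operators, as quadratic forms. -/
theorem sum_raise_sq_sub_sum_lower_sq (v : (Fin n → Bool) → ℝ) :
    ∑ y, raise v y ^ 2 - ∑ y, lower v y ^ 2 =
      ∑ y, ((n * (n + 1) / 2 : ℝ) - 2 * rank y) * v y ^ 2 := by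
  rw [sum_raise_sq, sum_lower_sq, ← sum_sub_distrib]
  have key : ∀ i : Fin n, (∑ j, √(coeff i) * √(coeff j) *
      ∑ z, if CanRaise i z ∧ CanLower j (flipAt i z) then v z * v (flipAt j (flipAt i z)) else 0) -
      (∑ j, √(coeff i) * √(coeff j) *
      ∑ z, if CanLower j z ∧ CanRaise i (flipAt j z) then v z * v (flipAt j (flipAt i z)) else 0) =
      ∑ z, coeff i * ((if CanRaise i z then 1 else 0) - if CanLower i z then 1 else 0) *
        v z ^ 2 := by
    intro i
    -- Only `j = i` survives, where the double flip is the identity.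
    rw [← sum_sub_distrib, sum_eq_single i]
    · rw [Real.mul_self_sqrt (coeff_pos i).le, ← mul_sub, ← sum_sub_distrib, mul_sum]
      refine sum_congr rfl fun z _ => ?_
      simp only [canRaise_flipAt, canLower_flipAt, flipAt_flipAt, and_self]
      split_ifs <;> ring
    · intro j _ hj
      simp only [canRaise_and_canLower_flipAt hj.symm, sub_self]
    · simp
  rw [sum_congr rfl fun i _ => key i, sum_comm]
  refine sum_congr rfl fun z _ => ?_
  rw [← sum_mul, sum_coeff_mul]

/-- On level `r` the commutation relation says that `‖raise v‖²` is `‖lower v‖²` plus a positive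
multiple of `‖v‖²`. -/
theorem eq_zero_of_raise_eq_zero {r : ℕ} (hr : 4 * r < n * (n + 1)) {v : (Fin n → Bool) → ℝ}
    (hv : ∀ x, rank x ≠ r → v x = 0) (h : raise v = 0) : v = 0 := by
  have hr' : (4 * r : ℝ) < n * (n + 1) := by exact_mod_cast hr
  have key := sum_raise_sq_sub_sum_lower_sq v
  have e : ∀ y, ((n * (n + 1) / 2 : ℝ) - 2 * rank y) * v y ^ 2 =
      ((n * (n + 1) / 2 : ℝ) - 2 * r) * v y ^ 2 := by
    intro y
    by_cases hy : rank y = r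
    · rw [hy]
    · simp [hv y hy]
  rw [sum_congr rfl fun y _ => e y, ← mul_sum, h] at key
  have h1 : 0 ≤ ∑ y, lower v y ^ 2 := sum_nonneg fun _ _ => sq_nonneg _
  have h2 : 0 ≤ ∑ y, v y ^ 2 := sum_nonneg fun _ _ => sq_nonneg _
  simp only [Pi.zero_apply, ne_eq, OfNat.ofNat_ne_zero, not_false_eq_true, zero_pow,
    sum_const_zero, zero_sub] at key
  have h3 : ∑ y, v y ^ 2 = 0 := by nlinarith
  funext y
  exact pow_eq_zero_iff two_ne_zero |>.1
    ((sum_eq_zero_iff_of_nonneg fun _ _ => sq_nonneg _).1 h3 y (mem_univ y))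

theorem eq_zero_of_lower_eq_zero {r : ℕ} (hr : n * (n + 1) < 4 * r) {v : (Fin n → Bool) → ℝ}
    (hv : ∀ x, rank x ≠ r → v x = 0) (h : lower v = 0) : v = 0 := by
  have hr' : (n * (n + 1) : ℝ) < 4 * r := by exact_mod_cast hr
  have key := sum_raise_sq_sub_sum_lower_sq v
  have e : ∀ y, ((n * (n + 1) / 2 : ℝ) - 2 * rank y) * v y ^ 2 =
      ((n * (n + 1) / 2 : ℝ) - 2 * r) * v y ^ 2 := by
    intro y
    by_cases hy : rank y = r
    · rw [hy]
    · simp [hv y hy]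
  rw [sum_congr rfl fun y _ => e y, ← mul_sum, h] at key
  have h1 : 0 ≤ ∑ y, raise v y ^ 2 := sum_nonneg fun _ _ => sq_nonneg _
  have h2 : 0 ≤ ∑ y, v y ^ 2 := sum_nonneg fun _ _ => sq_nonneg _
  simp only [Pi.zero_apply, ne_eq, OfNat.ofNat_ne_zero, not_false_eq_true, zero_pow,
    sum_const_zero, sub_zero] at key
  have h3 : ∑ y, v y ^ 2 = 0 := by nlinarith
  funext y
  exact pow_eq_zero_iff two_ne_zero |>.1
    ((sum_eq_zero_iff_of_nonneg fun _ _ => sq_nonneg _).1 h3 y (mem_univ y))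

/-! ### Matchings from injectivity -/

/-- If a linear operator whose matrix is supported on the relation `y ∈ t x` is injective on the
functions supported on `L`, then there is a matching of `L` along `t`. -/
theorem exists_matching_of_injective {α : Type*} [Fintype α] [DecidableEq α]
    (T : (α → ℝ) →ₗ[ℝ] (α → ℝ)) (t : α → Finset α)
    (ht : ∀ v y, (∀ x, y ∈ t x → v x = 0) → T v y = 0) (L : Set α)
    (hT : ∀ v : α → ℝ, (∀ x, x ∉ L → v x = 0) → T v = 0 → v = 0) :
    ∃ f : L → α, Function.Injective f ∧ ∀ x : L, f x ∈ t x := by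
  refine (Finset.all_card_le_biUnion_card_iff_exists_injective fun x : L => t x).1 fun S => ?_
  set S' : Finset α := S.map (Function.Embedding.subtype _) with hS'
  have hS'L : ∀ x ∈ S', x ∈ L := by
    intro x hx
    obtain ⟨z, _, rfl⟩ := mem_map.1 hx
    exact z.2
  set U : Finset α := S.biUnion fun x : L => t x
  have hU' : ∀ x ∈ S', ∀ y ∈ t x, y ∈ U := by
    intro x hx y hy
    obtain ⟨z, hz, rfl⟩ := mem_map.1 hx
    exact mem_biUnion.2 ⟨z, hz, hy⟩
  let E : (S' → ℝ) →ₗ[ℝ] (α → ℝ) := Function.ExtendByZero.linearMap ℝ Subtype.val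
  have hE1 : ∀ (v : S' → ℝ) (x : S'), E v x = v x := fun v x =>
    Subtype.val_injective.extend_apply v (0 : α → ℝ) x
  have hE0 : ∀ (v : S' → ℝ) (x : α), x ∉ S' → E v x = 0 := fun v x hx =>
    Function.extend_apply' v (0 : α → ℝ) x (by rintro ⟨a, rfl⟩; exact hx a.2)
  -- Hall's condition by dimension count: functions on `S'` are sent by `T` to functions vanishing
  -- off the neighbourhood `U`, so reading off the values on `U` loses nothing.
  let F : (S' → ℝ) →ₗ[ℝ] (U → ℝ) := LinearMap.funLeft ℝ ℝ (Subtype.val : U → α) ∘ₗ T ∘ₗ E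
  have hF : Function.Injective F := by
    rw [← LinearMap.ker_eq_bot, LinearMap.ker_eq_bot']
    intro v hv
    have h0 : T (E v) = 0 := by
      funext y
      by_cases hy : y ∈ U
      · exact congrFun hv ⟨y, hy⟩
      · refine ht _ _ fun x hx => hE0 v x fun hxS => hy (hU' x hxS y hx)
    have := hT (E v) (fun x hx => hE0 v x fun hxS => hx (hS'L x hxS)) h0
    funext x
    rw [← hE1 v x, this]
    rfl
  have := LinearMap.finrank_le_finrank_of_injective hF
  simpa [hS'] using this

theorem exists_raising_matching {r : ℕ} (hr : 4 * r < n * (n + 1)) :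
    ∃ f : {x : Fin n → Bool | rank x = r} → Fin n → Bool, Function.Injective f ∧
      ∀ x, Le₁ x.1 (f x) ∧ rank (f x) = r + 1 := by
  obtain ⟨f, hf, hft⟩ := exists_matching_of_injective raise
    (fun x : Fin n → Bool => (univ.filter fun i => CanRaise i x).image fun i => flipAt i x)
    (by
      intro v y h
      rw [raise_apply]
      refine sum_eq_zero fun i _ => ?_
      split_ifs with hi
      · rw [h, mul_zero]
        exact mem_image.2 ⟨i, by simpa [canRaise_flipAt] using hi, flipAt_flipAt i y⟩
      · rfl)
    {x | rank x = r} (fun v hv h => eq_zero_of_raise_eq_zero hr hv h)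
  refine ⟨f, hf, fun x => ?_⟩
  obtain ⟨i, hi, e⟩ := mem_image.1 (hft x)
  have := step_and_rank_flipAt (mem_filter.1 hi).2
  rw [← e, this.2, x.2]
  exact ⟨Relation.ReflTransGen.single this.1, rfl⟩

theorem exists_lowering_matching {r : ℕ} (hr : n * (n + 1) < 4 * r) :
    ∃ f : {x : Fin n → Bool | rank x = r} → Fin n → Bool, Function.Injective f ∧
      ∀ x, Le₁ (f x) x.1 ∧ rank (f x) + 1 = r := by
  obtain ⟨f, hf, hft⟩ := exists_matching_of_injective lower
    (fun x : Fin n → Bool => (univ.filter fun i => CanLower i x).image fun i => flipAt i x)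
    (by
      intro v y h
      rw [lower_apply]
      refine sum_eq_zero fun i _ => ?_
      split_ifs with hi
      · rw [h, mul_zero]
        exact mem_image.2 ⟨i, by simpa [canLower_flipAt] using hi, flipAt_flipAt i y⟩
      · rfl)
    {x | rank x = r} (fun v hv h => eq_zero_of_lower_eq_zero hr hv h)
  refine ⟨f, hf, fun x => ?_⟩
  obtain ⟨i, hi, e⟩ := mem_image.1 (hft x)
  have := step_and_rank_flipAt ((canRaise_flipAt i x.1).2 (mem_filter.1 hi).2)
  rw [flipAt_flipAt, e] at this
  exact ⟨Relation.ReflTransGen.single this.1, this.2.symm.trans x.2⟩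

/-! ### Pushing antichains to the middle level -/

/-- If each level below `m` is matched into the next one, then every antichain can be replaced by
one of the same size with no element below level `m`. -/
theorem exists_antichain_le_rank {α : Type*} [DecidableEq α] (R : α → α → Prop)
    (htrans : ∀ {x y z}, R x y → R y z → R x z) (rk : α → ℤ)
    (hrk : ∀ {x y}, R x y → x = y ∨ rk x < rk y) (m : ℤ)
    (hm : ∀ r < m, ∃ f : {x | rk x = r} → α, Function.Injective f ∧
      ∀ x, R x.1 (f x) ∧ rk (f x) = r + 1)
    (A : Finset α) (hA : IsAntichain R (A : Set α)) :
    ∃ B : Finset α, IsAntichain R (B : Set α) ∧ B.card = A.card ∧ (∀ x ∈ B, m ≤ rk x) ∧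
      ((∀ x ∈ A, rk x ≤ m) → ∀ x ∈ B, rk x ≤ m) := by
  suffices H : ∀ (d : ℕ) (A : Finset α), IsAntichain R (A : Set α) → (∀ x ∈ A, m - d ≤ rk x) →
      ∃ B : Finset α, IsAntichain R (B : Set α) ∧ B.card = A.card ∧ (∀ x ∈ B, m ≤ rk x) ∧
        ((∀ x ∈ A, rk x ≤ m) → ∀ x ∈ B, rk x ≤ m) by
    -- Any bound on the depth of `A` below `m` would do; the total deficit is one.
    refine H (∑ x ∈ A, (m - rk x).toNat) A hA fun x hx => ?_
    have := single_le_sum (f := fun x => (m - rk x).toNat) (fun _ _ => Nat.zero_le _) hx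
    have h2 := Int.self_le_toNat (m - rk x)
    omega
  intro d
  induction d with
  | zero =>
    intro A hA h
    exact ⟨A, hA, rfl, by simpa using h, fun h => h⟩
  | succ d ih =>
    intro A hA h
    push_cast at h
    obtain ⟨f, hf, hfR⟩ := hm (m - (d + 1)) (by omega)
    set g : α → α := fun x => if hx : rk x = m - (d + 1) then f ⟨x, hx⟩ else x with hg
    have g1 : ∀ x, rk x = m - (d + 1) → R x (g x) ∧ rk (g x) = m - (d + 1) + 1 := by
      intro x hx
      simp only [hg, dif_pos hx]
      exact hfR ⟨x, hx⟩
    have g2 : ∀ x, rk x ≠ m - (d + 1) → g x = x := by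
      intro x hx
      simp only [hg, dif_neg hx]
    -- An element above `g x` is above `x`; one strictly below `g x` would have to lie on the lowest
    -- level, which is excluded for `y`.
    have mixed : ∀ x ∈ A, ∀ y ∈ A, rk x = m - (d + 1) → rk y ≠ m - (d + 1) →
        ¬ R (g x) y ∧ ¬ R y (g x) ∧ g x ≠ y := by
      intro x hx y hy h1 h2
      have hxy : x ≠ y := by rintro rfl; exact h2 h1
      have n1 : g x ≠ y := fun e => hA hx hy hxy (e ▸ (g1 x h1).1)
      refine ⟨fun h' => hA hx hy hxy (htrans (g1 x h1).1 h'), fun h' => ?_, n1⟩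
      rcases hrk h' with e | e
      · exact n1 e.symm
      · have := h y hy
        rw [(g1 x h1).2] at e
        omega
    have ginj : Set.InjOn g A := by
      intro x hx y hy e
      by_cases h1 : rk x = m - (d + 1) <;> by_cases h2 : rk y = m - (d + 1)
      · simp only [hg, dif_pos h1, dif_pos h2] at e
        exact congrArg Subtype.val (hf e)
      · exact absurd (e.trans (g2 y h2)) (mixed x hx y hy h1 h2).2.2
      · exact absurd (e.symm.trans (g2 x h1)) (mixed y hy x hx h2 h1).2.2
      · rwa [g2 x h1, g2 y h2] at e
    have hB : IsAntichain R ((A.image g : Finset α) : Set α) := by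
      intro a ha b hb hab
      obtain ⟨x, hx, rfl⟩ := mem_image.1 ha
      obtain ⟨y, hy, rfl⟩ := mem_image.1 hb
      by_cases h1 : rk x = m - (d + 1) <;> by_cases h2 : rk y = m - (d + 1)
      · intro h'
        rcases hrk h' with e | e
        · exact hab e
        · rw [(g1 x h1).2, (g1 y h2).2] at e
          exact lt_irrefl _ e
      · rw [g2 y h2]
        exact (mixed x hx y hy h1 h2).1
      · rw [g2 x h1]
        exact (mixed y hy x hx h2 h1).2.1
      · rw [g2 x h1, g2 y h2] at hab ⊢
        exact hA hx hy hab
    obtain ⟨B, hB1, hB2, hB3, hB4⟩ := ih _ hB (by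
      intro a ha
      obtain ⟨x, hx, rfl⟩ := mem_image.1 ha
      by_cases h1 : rk x = m - (d + 1)
      · rw [(g1 x h1).2]
        omega
      · rw [g2 x h1]
        have := h x hx
        omega)
    refine ⟨B, hB1, hB2.trans (card_image_of_injOn ginj), hB3, fun hle => hB4 fun a ha => ?_⟩
    obtain ⟨x, hx, rfl⟩ := mem_image.1 ha
    by_cases h1 : rk x = m - (d + 1)
    · rw [(g1 x h1).2]
      omega
    · rw [g2 x h1]
      exact hle x hx

/-- The weights `n - i` run through `1, …, n`, so a point of the cube amounts to the set of weights
of its ones. -/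
theorem card_rank_eq (s : ℕ) :
    (univ.filter fun x : Fin n → Bool => rank x = s).card = countSum n s := by
  have hinj : Function.Injective fun i : Fin n => n - i.val := by
    intro i j h
    have := i.isLt
    have := j.isLt
    simp only at h
    exact Fin.ext (by omega)
  have hrank : ∀ x : Fin n → Bool,
      ∑ k ∈ (univ.filter fun i => x i = true).image (fun i : Fin n => n - i.val), k = rank x := by
    intro x
    rw [sum_image hinj.injOn, sum_filter, rank]
  unfold countSum
  refine card_bij'
    (fun x _ => (univ.filter fun i => x i = true).image fun i : Fin n => n - i.val)
    (fun T _ i => decide (n - i.val ∈ T)) ?_ ?_ ?_ ?_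
  · intro x hx
    refine mem_filter.2 ⟨mem_powerset.2 fun k hk => ?_, (hrank x).trans (mem_filter.1 hx).2⟩
    obtain ⟨i, _, rfl⟩ := mem_image.1 hk
    have := i.isLt
    exact mem_Icc.2 ⟨by omega, by omega⟩
  · intro T hT
    refine mem_filter.2 ⟨mem_univ _, ?_⟩
    obtain ⟨hT1, hT2⟩ := mem_filter.1 hT
    rw [← hrank, ← hT2]
    congr 1
    ext k
    simp only [decide_eq_true_eq, mem_image, mem_filter, mem_univ, true_and]
    constructor
    · rintro ⟨i, hi, rfl⟩
      exact hi
    · intro hk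
      have := mem_Icc.1 (mem_powerset.1 hT1 hk)
      have e : n - (n - k) = k := by omega
      exact ⟨⟨n - k, by omega⟩, by simpa only [e] using hk, e⟩
  · intro x _
    funext i
    rw [Bool.eq_iff_iff, decide_eq_true_eq]
    constructor
    · intro h
      obtain ⟨j, hj, e⟩ := mem_image.1 h
      exact hinj e ▸ (mem_filter.1 hj).2
    · intro h
      exact mem_image.2 ⟨i, mem_filter.2 ⟨mem_univ i, h⟩, rfl⟩
  · intro T hT
    have hT1 := (mem_filter.1 hT).1
    ext k
    simp only [decide_eq_true_eq, mem_image, mem_filter, mem_univ, true_and]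
    constructor
    · rintro ⟨i, hi, rfl⟩
      exact hi
    · intro hk
      have := mem_Icc.1 (mem_powerset.1 hT1 hk)
      have e : n - (n - k) = k := by omega
      exact ⟨⟨n - k, by omega⟩, by simpa only [e] using hk, e⟩

theorem isAntichain_rank_eq (s : ℕ) :
    IsAntichain Le₁ {x : Fin n → Bool | rank x = s} := by
  intro x hx y hy hxy h
  rcases h.eq_or_rank_lt with e | e
  · exact hxy e
  · exact e.ne (Eq.trans hx (Eq.symm hy))

/-- The middle level is an antichain of maximal size. -/
theorem card_le_countSum_of_isAntichain (A : Finset (Fin n → Bool))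
    (hA : IsAntichain Le₁ (A : Set (Fin n → Bool))) :
    A.card ≤ countSum n (n * (n + 1) / 4) := by
  obtain ⟨B, hB, hBc, hBm, -⟩ := exists_antichain_le_rank Le₁ Relation.ReflTransGen.trans
    (fun x : Fin n → Bool => (rank x : ℤ))
    (fun h => h.eq_or_rank_lt.imp_right fun h => by exact_mod_cast h)
    ((n * (n + 1) / 4 : ℕ) : ℤ) (by
      intro r hr
      rcases lt_or_ge r 0 with h0 | h0
      -- Negative levels are empty.
      · exact ⟨fun x => x.1, Subtype.val_injective, fun x => absurd x.2 (by
          simp only [Set.mem_ofPred_eq]; omega)⟩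
      lift r to ℕ using h0
      obtain ⟨f, hf, hfR⟩ := exists_raising_matching (n := n) (r := r) (by omega)
      refine ⟨fun x => f ⟨x.1, Nat.cast_injective x.2⟩, fun x y e => ?_, fun x => ?_⟩
      · exact Subtype.ext (congrArg (fun z => z.1) (hf e))
      · have := hfR ⟨x.1, Nat.cast_injective x.2⟩
        exact ⟨this.1, by exact_mod_cast this.2⟩) A hA
  -- The same push in the reversed order, with rank negated (hence integer ranks). The last clause
  -- keeps this pass from going below the middle level.
  obtain ⟨C, -, hCc, hCm, hCm'⟩ := exists_antichain_le_rank (fun x y => Le₁ y x)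
    (fun h h' => Relation.ReflTransGen.trans h' h)
    (fun x : Fin n → Bool => -(rank x : ℤ))
    (fun h => h.eq_or_rank_lt.imp Eq.symm fun h => by omega)
    (-((n * (n + 1) / 4 : ℕ) : ℤ)) (by
      intro r hr
      obtain ⟨q, rfl⟩ : ∃ q : ℕ, r = -q := ⟨r.natAbs, by omega⟩
      obtain ⟨f, hf, hfR⟩ := exists_lowering_matching (n := n) (r := q) (by omega)
      refine ⟨fun x => f ⟨x.1, Nat.cast_injective (neg_injective x.2)⟩, fun x y e => ?_,
        fun x => ?_⟩
      · exact Subtype.ext (congrArg (fun z => z.1) (hf e))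
      · have := hfR ⟨x.1, Nat.cast_injective (neg_injective x.2)⟩
        exact ⟨this.1, by have := this.2; dsimp only; omega⟩) B
    (fun x hx y hy hxy => hB hy hx hxy.symm)
  have hCm'' := hCm' fun x hx => neg_le_neg (hBm x hx)
  rw [← hBc, ← hCc, ← card_rank_eq]
  refine card_le_card fun x hx => mem_filter.2 ⟨mem_univ x, ?_⟩
  have h1 := hCm x hx
  have h2 := hCm'' x hx
  omega

end PolarOrder

theorem lemma1 (n : ℕ) :
    IsGreatest
      {c : ℕ | ∃ A : Finset (Fin n → Bool),
        IsAntichain PolarOrder.Le₁ (A : Set (Fin n → Bool)) ∧ A.card = c}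
      (PolarOrder.M n) := by
  obtain ⟨⟨s, hs⟩, hM⟩ := PolarOrder.isGreatest_M n
  refine ⟨⟨Finset.univ.filter fun x => PolarOrder.rank x = s, ?_, ?_⟩, ?_⟩
  · simpa using PolarOrder.isAntichain_rank_eq s
  · rw [PolarOrder.card_rank_eq, hs]
  · rintro _ ⟨A, hA, rfl⟩
    exact (PolarOrder.card_le_countSum_of_isAntichain A hA).trans (hM ⟨_, rfl⟩)
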